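/- Let $f:2^{X}\to\mathbb{Z}$ be a submodular function on an $n$-element ground set $X=\{1,\dots,n\}$, $n\ge 1$, i.e. $f(S\cup U)+f(S\cap U)\le f(S)+f(U)$ for all $S,U\subseteq X$. Let $F=\max_{i\in S\subseteq X}|f(S)-f(S\setminus\{i\})|$ be the maximum marginal difference in absolute value (with $F$ replaced by $1$ if $f$ is constant), and suppose that $f$ is accessible through a value oracle that takes time $\mathcal{T}\ge 1$ per query. There is an algorithm that returns an exact minimizer of $f$, i.e. a set $S$ with $f(S)\le f(A)$ for all $A\subseteq X$, in time $\tilde O(n^{6}F^{2}\cdot\mathcal{T})$. There is also an algorithm that, for every real $k$ with $0<k\le n$, returns a $k$-additive approximation to the minimizer, i.e. a set $S$ with $f(S)\le f(A)+k$ for all $A\subseteq X$, in time $\tilde O\left(\frac{n^{6}F^{2}}{k^{4}}\cdot\mathcal{T}\right)$. Here $\tilde O(g\cdot\mathcal T)$ means at most $C\,g\,\mathcal{T}\,\log^{c}(nF+2)$ with absolute constants $C,c$. An algorithm is a single deterministic program (independent of $n,f,k,\mathcal{T}$) of a random access machine that performs integer arithmetic, comparisons and memory accesses in unit time on words of $O(\log(n+\max_{S}|f(S)|+2))$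 bits. Its input is $n$ (and $\lfloor k\rfloor$ in the second case; as $f$ is integer-valued, being a $k$-additive and being a $\lfloor k\rfloor$-additive approximation are the same). It is not given $F$ or $\mathcal T$, and reads $f$ only through the oracle. -/

import Mathlib

/-- Submodularity of an integer-valued set function on a ground set of `n` elements. -/
def IsSubmodular {n : ℕ} (f : Finset (Fin n) → ℤ) : Prop :=
  ∀ S T : Finset (Fin n), f (S ∪ T) + f (S ∩ T) ≤ f S + f T

/-- `F = max_{i ∈ S ⊆ X} |f(S) - f(S \ {i})|`, the maximum marginal difference
in absolute value. -/
def maxMarginal {n : ℕ} (f : Finset (Fin n) → ℤ) : ℕ :=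
  Finset.univ.sup fun S : Finset (Fin n) => S.sup fun i => (f S - f (S.erase i)).natAbs

/-- The largest absolute value taken by `f`; it only enters the word size of the machine. -/
def maxAbs {n : ℕ} (f : Finset (Fin n) → ℤ) : ℕ :=
  Finset.univ.sup fun S : Finset (Fin n) => (f S).natAbs

/-! ### A random access machine with bounded words and a value oracle

Programs use finitely many integer registers and finitely many integer arrays (random access),
both named by natural numbers. -/

namespace RAM

/-- The arithmetic instructions. -/
inductive Op
  | add
  | sub
  | mul
  | div

/-- `div` is integer division with nonnegative remainder, with value `0` if the divisor is `0`. -/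
def Op.eval : Op → ℤ → ℤ → ℤ
  | .add, a, b => a + b
  | .sub, a, b => a - b
  | .mul, a, b => a * b
  | .div, a, b => a / b

/-- Structured RAM programs. Letters `x y z` are names of registers, `A` is the name of an
array. -/
inductive Prog
  /-- do nothing -/
  | skip
  /-- `x := v` for a literal `v` -/
  | const (x : ℕ) (v : ℤ)
  /-- `x := y o z` -/
  | arith (o : Op) (x y z : ℕ)
  /-- `x := A[y]` -/
  | load (x A y : ℕ)
  /-- `A[y] := x` -/
  | store (A y x : ℕ)
  /-- `x := f(S)`, where `S` is the set whose indicator vector stands in `A` -/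
  | query (x A : ℕ)
  /-- `p; q` -/
  | seq (p q : Prog)
  /-- `if x < y then p else q` -/
  | branch (x y : ℕ) (p q : Prog)
  /-- `while x < y do p` -/
  | loop (x y : ℕ) (p : Prog)

/-- Contents of the registers and of the arrays. -/
structure State where
  reg : ℕ → ℤ
  arr : ℕ → ℕ → ℤ

/-- Overwrite register `x` by `v`. -/
def State.setReg (s : State) (x : ℕ) (v : ℤ) : State :=
  { s with reg := Function.update s.reg x v }

/-- Overwrite cell `i` of array `A` by `v`. -/
def State.setArr (s : State) (A i : ℕ) (v : ℤ) : State :=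
  { s with arr := Function.update s.arr A (Function.update (s.arr A) i v) }

/-- The subset of `{0, …, n-1}` whose indicator vector stands in the first `n` cells of `A`. -/
def State.readSet (s : State) (n A : ℕ) : Finset (Fin n) :=
  Finset.univ.filter fun i : Fin n => s.arr A (i : ℕ) ≠ 0

/-- Initially register `0` holds `n`, register `1` holds the parameter `m`, and
everything else is `0`. -/
def State.init (n m : ℕ) : State where
  reg := fun x => if x = 0 then (n : ℤ) else if x = 1 then (m : ℤ) else 0
  arr := fun _ _ => 0

/-- `Exec f T W p s s' t`: with access to `f` by an oracle that takes time `T` per query, the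
program `p` started in `s` halts in `s'` after time exactly `t`. Every instruction other than a
query, and every evaluation of a test, takes one unit of time. A word holds the
integers of absolute value at most `W`; a program that computes a number that does not fit in
a word, or that uses a negative array index, is stuck and has no execution. -/
inductive Exec {n : ℕ} (f : Finset (Fin n) → ℤ) (T W : ℕ) :
    Prog → State → State → ℕ → Prop
  | skip (s : State) : Exec f T W .skip s s 1
  | const (s : State) (x : ℕ) (v : ℤ) (hv : |v| ≤ (W : ℤ)) :
      Exec f T W (.const x v) s (s.setReg x v) 1
  | arith (s : State) (o : Op) (x y z : ℕ) (hv : |o.eval (s.reg y) (s.reg z)| ≤ (W : ℤ)) :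
      Exec f T W (.arith o x y z) s (s.setReg x (o.eval (s.reg y) (s.reg z))) 1
  | load (s : State) (x A y i : ℕ) (hi : s.reg y = (i : ℤ)) :
      Exec f T W (.load x A y) s (s.setReg x (s.arr A i)) 1
  | store (s : State) (A y x i : ℕ) (hi : s.reg y = (i : ℤ)) :
      Exec f T W (.store A y x) s (s.setArr A i (s.reg x)) 1
  | query (s : State) (x A : ℕ) (hv : |f (s.readSet n A)| ≤ (W : ℤ)) :
      Exec f T W (.query x A) s (s.setReg x (f (s.readSet n A))) T
  | seq (p q : Prog) (s s₁ s₂ : State) (t₁ t₂ : ℕ)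
      (hp : Exec f T W p s s₁ t₁) (hq : Exec f T W q s₁ s₂ t₂) :
      Exec f T W (.seq p q) s s₂ (t₁ + t₂)
  | branchTrue (x y : ℕ) (p q : Prog) (s s' : State) (t : ℕ)
      (h : s.reg x < s.reg y) (hp : Exec f T W p s s' t) :
      Exec f T W (.branch x y p q) s s' (t + 1)
  | branchFalse (x y : ℕ) (p q : Prog) (s s' : State) (t : ℕ)
      (h : ¬ s.reg x < s.reg y) (hq : Exec f T W q s s' t) :
      Exec f T W (.branch x y p q) s s' (t + 1)
  | loopStop (x y : ℕ) (p : Prog) (s : State)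
      (h : ¬ s.reg x < s.reg y) :
      Exec f T W (.loop x y p) s s 1
  | loopStep (x y : ℕ) (p : Prog) (s s₁ s₂ : State) (t₁ t₂ : ℕ)
      (h : s.reg x < s.reg y) (hp : Exec f T W p s s₁ t₁)
      (hl : Exec f T W (.loop x y p) s₁ s₂ t₂) :
      Exec f T W (.loop x y p) s s₂ (t₁ + t₂ + 1)

/-- On input `n`, `m` and with oracle access to `f`, the program `P` halts after time
exactly `t` and returns the set `S`; the result is read off array `0`. -/
def Prog.Returns {n : ℕ} (P : Prog) (f : Finset (Fin n) → ℤ) (T W m : ℕ)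
    (S : Finset (Fin n)) (t : ℕ) : Prop :=
  ∃ s : State, Exec f T W P (State.init n m) s t ∧ s.readSet n 0 = S

end RAM

/-! The algorithm is projected subgradient descent for the Lovász extension of `f` on the cube,
scaled to `[0, D]^n` so that unit steps keep all arithmetic integral. At a point `y₀` the elements
are taken in decreasing order of their coordinates. The marginals of `f` along this chain form a
subgradient; it is subtracted from `y₀` and the result is clamped to the box.

The potential of a set `A` is the squared distance from the point to `D` times the indicator of `A`.
One step lowers it by at least `2D(b - f A) - nF²`, where `b` is the least value of `f` seen so far:
Abel summation bounds the extension at `y₀` from below through `b`, submodularity bounds the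
subgradient at `A` from above, and clamping brings the point no farther from `A`. If `A` beats `b`
by more than `m`, integrality gives `b - f A ≥ m + 1`, so with `D(m + 1) ≥ nF²` the drop is at least
`D(m + 1)`. The potential starts at no more than `nD²`, so more than `nD/(m + 1)` steps would make
it negative. This needs about `n²F²/(m + 1)²` steps of cost `O(n(T + n))`, which is within the
claimed bound and has no logarithmic factor.

`F` is not given, but submodularity puts the extreme marginals at `∅` and at the full set, so `O(n)`
queries yield a usable bound. The analysis is carried by `GreedyInv.insert`,
`GreedyInv.potential_decrease` and `descentProg_spec`. -/

namespace RAM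

variable {n : ℕ} {f : Finset (Fin n) → ℤ} {T W : ℕ}

/-! ### Total-correctness rules with a clock for the machine. -/

@[simp] theorem State.setReg_reg (s : State) (x y : ℕ) (v : ℤ) :
    (s.setReg x v).reg y = if y = x then v else s.reg y := by
  simp [State.setReg, Function.update_apply]

@[simp] theorem State.setReg_arr (s : State) (x : ℕ) (v : ℤ) : (s.setReg x v).arr = s.arr := rfl

@[simp] theorem State.setArr_reg (s : State) (A i : ℕ) (v : ℤ) : (s.setArr A i v).reg = s.reg := rfl

@[simp] theorem State.setArr_arr (s : State) (A B i j : ℕ) (v : ℤ) :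
    (s.setArr A i v).arr B j = if B = A ∧ j = i then v else s.arr B j := by
  by_cases hB : B = A <;> simp [State.setArr, Function.update_apply, hB]

/-- `Wp f T W p Q s τ`: started in `s` at time `τ`, the program `p` halts in a state and at a
time that satisfy `Q`. -/
def Wp (f : Finset (Fin n) → ℤ) (T W : ℕ) (p : Prog) (Q : State → ℕ → Prop)
    (s : State) (τ : ℕ) : Prop :=
  ∃ s' t, Exec f T W p s s' t ∧ Q s' (τ + t)

theorem Wp.mono {p : Prog} {Q Q' : State → ℕ → Prop} {s : State} {τ : ℕ}
    (h : Wp f T W p Q s τ) (hQ : ∀ s' τ', Q s' τ' → Q' s' τ') : Wp f T W p Q' s τ := by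
  obtain ⟨s', t, he, hq⟩ := h
  exact ⟨s', t, he, hQ _ _ hq⟩

theorem Wp.skip {Q : State → ℕ → Prop} {s : State} {τ : ℕ} (h : Q s (τ + 1)) :
    Wp f T W .skip Q s τ := ⟨_, _, .skip s, h⟩

theorem Wp.const {Q : State → ℕ → Prop} {s : State} {τ x : ℕ} {v : ℤ}
    (hv : |v| ≤ (W : ℤ)) (h : Q (s.setReg x v) (τ + 1)) :
    Wp f T W (.const x v) Q s τ := ⟨_, _, .const s x v hv, h⟩

theorem Wp.arith {Q : State → ℕ → Prop} {s : State} {τ x y z : ℕ} {o : Op}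
    (hv : |o.eval (s.reg y) (s.reg z)| ≤ (W : ℤ))
    (h : Q (s.setReg x (o.eval (s.reg y) (s.reg z))) (τ + 1)) :
    Wp f T W (.arith o x y z) Q s τ := ⟨_, _, .arith s o x y z hv, h⟩

theorem Wp.load {Q : State → ℕ → Prop} {s : State} {τ x A y : ℕ} (i : ℕ)
    (hi : s.reg y = (i : ℤ)) (h : Q (s.setReg x (s.arr A i)) (τ + 1)) :
    Wp f T W (.load x A y) Q s τ := ⟨_, _, .load s x A y i hi, h⟩

theorem Wp.store {Q : State → ℕ → Prop} {s : State} {τ A y x : ℕ} (i : ℕ)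
    (hi : s.reg y = (i : ℤ)) (h : Q (s.setArr A i (s.reg x)) (τ + 1)) :
    Wp f T W (.store A y x) Q s τ := ⟨_, _, .store s A y x i hi, h⟩

theorem Wp.query {Q : State → ℕ → Prop} {s : State} {τ x A : ℕ} (S : Finset (Fin n))
    (hS : s.readSet n A = S) (hv : |f S| ≤ (W : ℤ)) (h : Q (s.setReg x (f S)) (τ + T)) :
    Wp f T W (.query x A) Q s τ := by
  subst hS
  exact ⟨_, _, .query s x A hv, h⟩

theorem Wp.seq {p q : Prog} {Q : State → ℕ → Prop} {s : State} {τ : ℕ}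
    (h : Wp f T W p (Wp f T W q Q) s τ) : Wp f T W (.seq p q) Q s τ := by
  obtain ⟨s₁, t₁, h₁, s₂, t₂, h₂, hq⟩ := h
  exact ⟨s₂, t₁ + t₂, .seq _ _ _ _ _ _ _ h₁ h₂, by rwa [← add_assoc]⟩

theorem Wp.branch {p q : Prog} {Q : State → ℕ → Prop} {s : State} {τ x y : ℕ}
    (hp : s.reg x < s.reg y → Wp f T W p Q s (τ + 1))
    (hq : s.reg y ≤ s.reg x → Wp f T W q Q s (τ + 1)) :
    Wp f T W (.branch x y p q) Q s τ := by
  by_cases h : s.reg x < s.reg y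
  · obtain ⟨s', t, he, hQ⟩ := hp h
    exact ⟨s', t + 1, .branchTrue _ _ _ _ _ _ _ h he, by rwa [add_comm t, ← add_assoc]⟩
  · obtain ⟨s', t, he, hQ⟩ := hq (not_lt.mp h)
    exact ⟨s', t + 1, .branchFalse _ _ _ _ _ _ _ h he, by rwa [add_comm t, ← add_assoc]⟩

/-- A loop that makes exactly `N` passes, each of cost at most `c`, with invariant `I`. -/
theorem Wp.loop {p : Prog} {s : State} {τ x y : ℕ} {Q : State → ℕ → Prop} (N c : ℕ)
    (I : ℕ → State → Prop) (h0 : I 0 s)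
    (hstep : ∀ j < N, ∀ s τ, I j s →
      s.reg x < s.reg y ∧ Wp f T W p (fun s' τ' => τ' ≤ τ + c ∧ I (j + 1) s') s τ)
    (hexit : ∀ s, I N s → s.reg y ≤ s.reg x)
    (hQ : ∀ s' τ', τ' ≤ τ + N * (c + 1) + 1 → I N s' → Q s' τ') :
    Wp f T W (.loop x y p) Q s τ := by
  -- The induction runs on the number `k` of passes still to be made.
  suffices H : ∀ k j, j + k = N → ∀ s, I j s → ∀ τ,
      Wp f T W (.loop x y p) (fun s' τ' => τ' ≤ τ + k * (c + 1) + 1 ∧ I N s') s τ by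
    exact (H N 0 (by omega) s h0 τ).mono fun s' τ' h => hQ s' τ' h.1 h.2
  intro k
  induction k with
  | zero =>
    intro j hj s hs τ
    obtain rfl : j = N := by omega
    exact ⟨s, 1, .loopStop _ _ _ _ (not_lt.mpr (hexit s hs)), by simp, hs⟩
  | succ k ih =>
    intro j hj s hs τ
    obtain ⟨hlt, s₁, t₁, h₁, ht₁, hI₁⟩ := hstep j (by omega) s 0 hs
    obtain ⟨s₂, t₂, h₂, ht₂, hI₂⟩ := ih (j + 1) (by omega) s₁ hI₁ 0
    refine ⟨s₂, t₁ + t₂ + 1, .loopStep _ _ _ _ _ _ _ _ hlt h₁ h₂, ?_, hI₂⟩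
    rw [Nat.succ_mul]
    omega

end RAM

/-! ### Marginals of submodular functions and the potential of a subgradient step. -/

section Submodular

variable {n : ℕ} {f : Finset (Fin n) → ℤ}

theorem abs_le_maxAbs (f : Finset (Fin n) → ℤ) (S : Finset (Fin n)) : |f S| ≤ (maxAbs f : ℤ) := by
  have : (f S).natAbs ≤ maxAbs f :=
    Finset.le_sup (f := fun S : Finset (Fin n) => (f S).natAbs) (Finset.mem_univ S)
  rw [Int.abs_eq_natAbs]
  omega

theorem abs_sub_erase_le_maxMarginal (f : Finset (Fin n) → ℤ) {S : Finset (Fin n)} {i : Fin n}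
    (hi : i ∈ S) : |f S - f (S.erase i)| ≤ (maxMarginal f : ℤ) := by
  have h₁ : (f S - f (S.erase i)).natAbs ≤ S.sup fun i => (f S - f (S.erase i)).natAbs :=
    Finset.le_sup (f := fun i => (f S - f (S.erase i)).natAbs) hi
  have h₂ : (S.sup fun i => (f S - f (S.erase i)).natAbs) ≤ maxMarginal f :=
    Finset.le_sup (f := fun S : Finset (Fin n) => S.sup fun i => (f S - f (S.erase i)).natAbs)
      (Finset.mem_univ S)
  rw [Int.abs_eq_natAbs]
  omega

/-- This lets a word size that depends only on `n` and `maxAbs f` hold the numbers built from `F`.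
-/
theorem maxMarginal_le (f : Finset (Fin n) → ℤ) : maxMarginal f ≤ 2 * maxAbs f := by
  refine Finset.sup_le fun S _ => Finset.sup_le fun i _ => ?_
  have h₁ := abs_le_maxAbs f S
  have h₂ := abs_le_maxAbs f (S.erase i)
  rw [abs_le] at h₁ h₂
  omega

/-- Diminishing returns. -/
theorem IsSubmodular.marginal_le (hf : IsSubmodular f) {R S : Finset (Fin n)} (hRS : R ⊆ S)
    {i : Fin n} (hi : i ∉ S) : f (insert i S) - f S ≤ f (insert i R) - f R := by
  have h := hf (insert i R) S
  have h₁ : insert i R ∪ S = insert i S := by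
    rw [Finset.insert_union, Finset.union_eq_right.mpr hRS]
  have h₂ : insert i R ∩ S = R := by
    rw [Finset.insert_inter_of_notMem hi, Finset.inter_eq_left.mpr hRS]
  rw [h₁, h₂] at h
  linarith

/-- Diminishing returns squeeze a marginal of `i` between its marginal at the complement of `i` and
its marginal at `∅`. Hence `2n` differences control all marginals, which makes a bound computable.
-/
theorem IsSubmodular.abs_marginal_le (hf : IsSubmodular f) {F : ℤ}
    (h₁ : ∀ i, f {i} - f ∅ ≤ F) (h₂ : ∀ i, f (Finset.univ.erase i) - f Finset.univ ≤ F)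
    {S : Finset (Fin n)} {i : Fin n} (hi : i ∉ S) : |f (insert i S) - f S| ≤ F := by
  have ha := hf.marginal_le (Finset.empty_subset S) hi
  have hb := hf.marginal_le (R := S) (S := Finset.univ.erase i)
    (fun x hx => Finset.mem_erase.mpr ⟨fun h => hi (h ▸ hx), Finset.mem_univ x⟩)
    (Finset.notMem_erase i _)
  rw [Finset.insert_erase (Finset.mem_univ i)] at hb
  have := h₁ i
  have := h₂ i
  simp only [insert_empty_eq] at ha
  rw [abs_le]
  constructor <;> linarith

/-- Projection onto `[0, D]`. -/
def clamp (D v : ℤ) : ℤ := min D (max 0 v)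

theorem clamp_nonneg {D : ℤ} (hD : 0 ≤ D) (v : ℤ) : 0 ≤ clamp D v := by
  unfold clamp; omega

theorem clamp_le (D v : ℤ) : clamp D v ≤ D := min_le_left _ _

theorem sq_clamp_sub_le {D v a : ℤ} (ha : 0 ≤ a) (haD : a ≤ D) :
    (clamp D v - a) ^ 2 ≤ (v - a) ^ 2 := by
  rw [sq_le_sq]
  unfold clamp
  rcases abs_cases (v - a) with h | h <;> rw [abs_le] <;> omega


/-- `D` times the indicator vector of `A`. -/
def scaledInd (D : ℤ) (A : Finset (Fin n)) (i : Fin n) : ℤ := if i ∈ A then D else 0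

/-- State of a greedy subgradient step after the elements of `S` have been processed: `y₀` is the
old point, `y` the new one, and `b` is at most the value of `f` at all sets seen so far. -/
structure GreedyInv (f : Finset (Fin n) → ℤ) (D F b : ℤ) (y₀ y : Fin n → ℤ)
    (S : Finset (Fin n)) : Prop where
  eq_of_notMem : ∀ i ∉ S, y i = y₀ i
  nonneg : ∀ i, 0 ≤ y i
  le : ∀ i, y i ≤ D
  sorted : ∀ i ∈ S, ∀ l ∉ S, y₀ l ≤ y₀ i
  best_le : b ≤ f S
  best_le_empty : b ≤ f ∅
  potential : ∀ A : Finset (Fin n), ∀ z ≤ D, (∀ i ∈ S, z ≤ y₀ i) →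
    ∑ i ∈ S, ((y i - scaledInd D A i) ^ 2 - (y₀ i - scaledInd D A i) ^ 2) +
      2 * ((b - f ∅) * (D - z) + z * (f S - f ∅)) - 2 * D * (f (S ∩ A) - f ∅) ≤ S.card * F ^ 2

theorem GreedyInv.empty {D F b : ℤ} {y : Fin n → ℤ} (h0 : ∀ i, 0 ≤ y i) (hD : ∀ i, y i ≤ D)
    (hb : b ≤ f ∅) : GreedyInv f D F b y y ∅ where
  eq_of_notMem _ _ := rfl
  nonneg := h0
  le := hD
  sorted := by simp
  best_le := hb
  best_le_empty := hb
  potential := by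
    intro A z hz _
    simp only [Finset.sum_empty, Finset.empty_inter, Finset.card_empty]
    push_cast
    nlinarith [mul_nonneg (sub_nonneg.mpr hb) (sub_nonneg.mpr hz)]

/-- The bracket in `potential` is an Abel-summation lower bound for the sum of `y₀ i` times the
marginal of `i`, with `z` standing for the next coordinate in the decreasing order. Keeping `z` free
makes the bound inductive. -/
theorem GreedyInv.insert (hf : IsSubmodular f) {D F b b' : ℤ} {y₀ y y' : Fin n → ℤ}
    {S : Finset (Fin n)} (h : GreedyInv f D F b y₀ y S) {j : Fin n} (hj : j ∉ S)
    (hF : |f (insert j S) - f S| ≤ F) (hmax : ∀ l ∉ S, y l ≤ y j)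
    (hb : b' ≤ b) (hb' : b' ≤ f (insert j S))
    (hyj : y' j = clamp D (y j - (f (insert j S) - f S))) (hy : ∀ i ≠ j, y' i = y i) :
    GreedyInv f D F b' y₀ y' (insert j S) := by
  have hD : 0 ≤ D := (h.nonneg j).trans (h.le j)
  have hj₀ : y j = y₀ j := h.eq_of_notMem j hj
  refine ⟨fun i hi => ?_, fun i => ?_, fun i => ?_, fun i hi l hl => ?_, hb',
    hb.trans h.best_le_empty, fun A z hz hzS => ?_⟩
  · simp only [Finset.mem_insert, not_or] at hi
    rw [hy i hi.1, h.eq_of_notMem i hi.2]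
  · by_cases hi : i = j
    · rw [hi, hyj]; exact clamp_nonneg hD _
    · rw [hy i hi]; exact h.nonneg i
  · by_cases hi : i = j
    · rw [hi, hyj]; exact clamp_le _ _
    · rw [hy i hi]; exact h.le i
  · simp only [Finset.mem_insert, not_or] at hi hl
    rcases hi with rfl | hi
    · rw [← hj₀, ← h.eq_of_notMem l hl.2]; exact hmax l hl.2
    · exact h.sorted i hi l hl.2
  · have hzj : z ≤ y₀ j := hzS j (Finset.mem_insert_self _ _)
    -- The old bound is used at the coordinate of the new element, the largest admissible level
    -- below the earlier ones.
    have hpot := h.potential A (y₀ j) (hj₀ ▸ h.le j) (fun i hi => h.sorted i hi j hj)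
    rw [Finset.sum_insert hj, Finset.card_insert_of_notMem hj]
    have hsum : ∑ i ∈ S, ((y' i - scaledInd D A i) ^ 2 - (y₀ i - scaledInd D A i) ^ 2) =
        ∑ i ∈ S, ((y i - scaledInd D A i) ^ 2 - (y₀ i - scaledInd D A i) ^ 2) :=
      Finset.sum_congr rfl fun i hi => by rw [hy i (fun h => hj (h ▸ hi))]
    rw [hsum, hyj, hj₀]
    set g := f (Insert.insert j S) - f S with hg
    have ha0 : 0 ≤ scaledInd D A j := by unfold scaledInd; split <;> simp [hD]
    have haD : scaledInd D A j ≤ D := by unfold scaledInd; split <;> simp [hD]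
    have hc := sq_clamp_sub_le (v := y₀ j - g) ha0 haD
    have hg2 : g ^ 2 ≤ F ^ 2 := sq_le_sq.mpr (hF.trans (le_abs_self F))
    -- The subgradient inequality at `A`, one element at a time: for `j ∈ A` the marginal at `S` is
    -- at most that at `S ∩ A`, and otherwise both sides vanish.
    have hA : scaledInd D A j * g ≤ D * (f (Insert.insert j S ∩ A) - f (S ∩ A)) := by
      unfold scaledInd
      split
      · rename_i hjA
        rw [Finset.insert_inter_of_mem hjA]
        exact mul_le_mul_of_nonneg_left (hf.marginal_le Finset.inter_subset_left hj) hD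
      · rename_i hjA
        rw [Finset.insert_inter_of_notMem hjA]
        simp
    -- `h₁` pays for lowering the level from `y₀ j` to `z`, and `h₂` for lowering the best value
    -- from `b` to `b'`.
    have h₁ : 0 ≤ (y₀ j - z) * (f (Insert.insert j S) - b') :=
      mul_nonneg (sub_nonneg.mpr hzj) (sub_nonneg.mpr hb')
    have h₂ : 0 ≤ (b - b') * (D - y₀ j) :=
      mul_nonneg (sub_nonneg.mpr hb) (sub_nonneg.mpr (hj₀ ▸ h.le j))
    push_cast
    have hfi : f (Insert.insert j S) = g + f S := by rw [hg]; ring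
    rw [hfi] at h₁ ⊢
    linarith [hc, hg2, hA, h₁, h₂, hpot, sq (y₀ j - g - scaledInd D A j)]

/-- A whole step decreases the potential of `A`, if `A` is better than all sets seen by more
than `m`. -/
theorem GreedyInv.potential_decrease {D F b m : ℤ} {y₀ y : Fin n → ℤ}
    (h : GreedyInv f D F b y₀ y Finset.univ) (hD0 : 0 ≤ D) (hy₀ : ∀ i, 0 ≤ y₀ i)
    (hD : n * F ^ 2 ≤ D * (m + 1)) {A : Finset (Fin n)} (hA : f A + m < b) :
    ∑ i, (y i - scaledInd D A i) ^ 2 ≤ ∑ i, (y₀ i - scaledInd D A i) ^ 2 - D * (m + 1) := by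
  -- At level `0` the bracket and the term of `A` combine to `2D(b - f A)`. One half absorbs `nF²`,
  -- the other is the gain.
  have hp := h.potential A 0 hD0 fun i _ => hy₀ i
  rw [Finset.sum_sub_distrib, Finset.univ_inter, Finset.card_univ, Fintype.card_fin] at hp
  have : D * (m + 1) ≤ D * (b - f A) := mul_le_mul_of_nonneg_left (by linarith) hD0
  linarith

theorem sum_sq_scaledInd_le (D : ℤ) (A : Finset (Fin n)) :
    ∑ i, (0 - scaledInd D A i) ^ 2 ≤ n * D ^ 2 := by
  calc ∑ i, (0 - scaledInd D A i) ^ 2 ≤ ∑ _i : Fin n, D ^ 2 := by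
        refine Finset.sum_le_sum fun i _ => ?_
        unfold scaledInd
        split
        · simp
        · simpa using sq_nonneg D
    _ = n * D ^ 2 := by simp

end Submodular

/-! ### Indicator vectors, counting loops and array programs. -/

namespace RAM

variable {n : ℕ} {f : Finset (Fin n) → ℤ} {T W : ℕ}

/-- The first `n` cells of array `3` hold the indicator vector of `S`. -/
def State.HasInd (s : State) (S : Finset (Fin n)) : Prop :=
  ∀ i : Fin n, s.arr 3 i = if i ∈ S then 1 else 0

theorem State.HasInd.readSet_eq {s : State} {S : Finset (Fin n)} (h : s.HasInd S) :
    s.readSet n 3 = S := by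
  ext i
  simp [State.readSet, h i]

theorem State.HasInd.insert {s : State} {S : Finset (Fin n)} (h : s.HasInd S) {i : Fin n}
    {s' : State} (hs' : ∀ l : ℕ, s'.arr 3 l = if l = i then 1 else s.arr 3 l) :
    s'.HasInd (insert i S) := by
  intro l
  rw [hs', h l]
  by_cases hl : l = i
  · simp [hl]
  · simp [hl, Fin.val_inj]

theorem State.HasInd.erase {s : State} {S : Finset (Fin n)} (h : s.HasInd S) {i : Fin n}
    {s' : State} (hs' : ∀ l : ℕ, s'.arr 3 l = if l = i then 0 else s.arr 3 l) :
    s'.HasInd (S.erase i) := by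
  intro l
  rw [hs', h l]
  by_cases hl : l = i
  · simp [hl]
  · simp [hl, Fin.val_inj]

theorem State.readSet_congr {s s' : State} {A B : ℕ} (h : ∀ i < n, s.arr A i = s'.arr B i) :
    s.readSet n A = s'.readSet n B := by
  ext i
  simp [State.readSet, h i i.2]

/-- `p; x := x + 1` repeated while `x < n`; register `3` holds `1`. -/
def forProg (x : ℕ) (p : Prog) : Prog := .loop x 0 (.seq p (.arith .add x x 3))

/-- A counting loop over `{0, …, n-1}`. -/
theorem Wp.for {x : ℕ} {p : Prog} {s : State} {τ : ℕ} {Q : State → ℕ → Prop} (c : ℕ)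
    (I : ℕ → State → Prop) (hx0 : x ≠ 0) (hx3 : x ≠ 3) (hn : n ≤ W)
    (hx : s.reg x = 0) (h0 : s.reg 0 = n) (h3 : s.reg 3 = 1) (hI : I 0 s)
    (hstep : ∀ j : ℕ, j < n → ∀ (s : State) (τ : ℕ), s.reg x = (j : ℤ) →
      s.reg 0 = (n : ℤ) → s.reg 3 = 1 → I j s →
      Wp f T W p (fun s' τ' => τ' ≤ τ + c ∧ s'.reg x = s.reg x ∧ s'.reg 0 = s.reg 0 ∧
        s'.reg 3 = s.reg 3 ∧ I (j + 1) (s'.setReg x (j + 1 : ℕ))) s τ)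
    (hQ : ∀ (s' : State) (τ' : ℕ), τ' ≤ τ + n * (c + 2) + 1 →
      s'.reg x = (n : ℤ) → s'.reg 0 = (n : ℤ) → s'.reg 3 = 1 →
      I n s' → Q s' τ') :
    Wp f T W (forProg x p) Q s τ := by
  refine Wp.loop n (c + 1) (fun j s => s.reg x = j ∧ s.reg 0 = n ∧ s.reg 3 = 1 ∧ I j s)
    ⟨by simpa using hx, h0, h3, hI⟩ ?_ (fun s h => by rw [h.1, h.2.1])
    (fun s' τ' h h' => hQ s' τ' h h'.1 h'.2.1 h'.2.2.1 h'.2.2.2)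
  rintro j hj s τ ⟨hx, h0, h3, hI⟩
  refine ⟨by rw [hx, h0]; exact_mod_cast hj, Wp.seq ?_⟩
  refine (hstep j hj s τ hx h0 h3 hI).mono fun s' τ' ⟨hτ, hx', h0', h3', hI'⟩ => ?_
  have hv : (Op.add.eval (s'.reg x) (s'.reg 3)) = ((j + 1 : ℕ) : ℤ) := by
    rw [hx', h3', hx, h3]; rfl
  refine Wp.arith ?_ ?_
  · rw [hv, abs_le]; omega
  · rw [hv]
    refine ⟨by omega, by simp, ?_, ?_, hI'⟩
    · simp [hx0.symm, h0', h0]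
    · simp [hx3.symm, h3', h3]

/-- Copies the first `n` cells of array `3` to array `0`. -/
def copyProg : Prog :=
  .seq (.const 11 0) (forProg 11 (.seq (.load 15 3 11) (.store 0 11 15)))

theorem copyProg_spec (hn : n ≤ W) (s : State) (τ : ℕ) (h0 : s.reg 0 = n) (h3 : s.reg 3 = 1) :
    Wp f T W copyProg (fun s' τ' => τ' ≤ τ + (4 * n + 2) ∧
      (∀ i < n, s'.arr 0 i = s.arr 3 i) ∧ (∀ A ≠ 0, s'.arr A = s.arr A) ∧
      ∀ r, r ≠ 11 → r ≠ 15 → s'.reg r = s.reg r) s τ := by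
  refine Wp.seq (Wp.const (by simp) ?_)
  refine Wp.for 2 (fun j s' => (∀ i < j, s'.arr 0 i = s.arr 3 i) ∧ (∀ A ≠ 0, s'.arr A = s.arr A) ∧
      ∀ r, r ≠ 11 → r ≠ 15 → s'.reg r = s.reg r) (by decide) (by decide) hn (by simp)
    (by simpa using h0) (by simpa using h3) ?_ ?_ ?_
  · refine ⟨by simp, by simp, fun r h _ => by simp [h]⟩
  · rintro j hj s₁ τ₁ hj₁ - - ⟨hc, hA, hr⟩
    refine Wp.seq (Wp.load j hj₁ (Wp.store j (by simpa using hj₁) ?_))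
    refine ⟨by omega, by simp, by simp, by simp, ?_, ?_, ?_⟩
    · intro i hi
      by_cases hij : i = j
      · simp [hij, hA]
      · simpa [hij] using hc i (by omega)
    · intro A hA0
      ext i
      simp [hA0, hA A hA0]
    · intro r h h'
      simp [h, h', hr r h h']
  · rintro s' τ' hτ - - - ⟨hc, hA, hr⟩
    exact ⟨by omega, hc, hA, hr⟩

/-- Stores the value of register `y` in the first `n` cells of array `3`. -/
def fillProg (y : ℕ) : Prog :=
  .seq (.const 11 0) (forProg 11 (.store 3 11 y))

theorem fillProg_spec (hn : n ≤ W) (y : ℕ) (hy : y ≠ 11) (s : State) (τ : ℕ)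
    (h0 : s.reg 0 = n) (h3 : s.reg 3 = 1) :
    Wp f T W (fillProg y) (fun s' τ' => τ' ≤ τ + (3 * n + 2) ∧
      (∀ i < n, s'.arr 3 i = s.reg y) ∧ (∀ A ≠ 3, s'.arr A = s.arr A) ∧
      ∀ r, r ≠ 11 → s'.reg r = s.reg r) s τ := by
  refine Wp.seq (Wp.const (by simp) ?_)
  refine Wp.for 1 (fun j s' => (∀ i < j, s'.arr 3 i = s.reg y) ∧ (∀ A ≠ 3, s'.arr A = s.arr A) ∧
      ∀ r, r ≠ 11 → s'.reg r = s.reg r) (by decide) (by decide) hn (by simp)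
    (by simpa using h0) (by simpa using h3) ?_ ?_ ?_
  · refine ⟨by simp, by simp, fun r h => by simp [h]⟩
  · rintro j hj s₁ τ₁ hj₁ - - ⟨hc, hA, hr⟩
    refine Wp.store j hj₁ ⟨by omega, by simp, by simp, by simp, ?_, ?_, ?_⟩
    · intro i hi
      by_cases hij : i = j
      · simp [hij, hr y hy]
      · simpa [hij] using hc i (by omega)
    · intro A hA0
      ext i
      simp [hA0, hA A hA0]
    · intro r h
      simp [h, hr r h]
  · rintro s' τ' hτ - - - ⟨hc, hA, hr⟩
    exact ⟨by omega, hc, hA, hr⟩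

/-! ### The greedy subgradient step as a program. -/

/-- Puts into register `13` an index outside the set in array `3` at which array `1` is largest,
and the value there into register `14`. -/
def selectProg : Prog :=
  .seq (.const 11 0) <| .seq (.const 13 0) <| .seq (.const 14 (-1)) <|
    forProg 11 <| .seq (.load 15 3 11) <|
      .branch 15 3
        (.seq (.load 16 1 11) <|
          .branch 14 16 (.seq (.arith .add 14 16 2) (.arith .add 13 11 2)) .skip)
        .skip

theorem selectProg_spec {D : ℤ} (hn : n ≤ W) (hW : 1 ≤ W) (hD : D ≤ W) (s : State) (τ : ℕ)
    (h0 : s.reg 0 = n) (h2 : s.reg 2 = 0) (h3 : s.reg 3 = 1) {S : Finset (Fin n)}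
    (hS : s.HasInd S) {a : Fin n} (ha : a ∉ S)
    (hy0 : ∀ i : Fin n, 0 ≤ s.arr 1 i) (hyD : ∀ i : Fin n, s.arr 1 i ≤ D) :
    Wp f T W selectProg (fun s' τ' => τ' ≤ τ + (8 * n + 4) ∧
      (∃ b : Fin n, b ∉ S ∧ s'.reg 13 = b ∧ s'.reg 14 = s.arr 1 b ∧
        ∀ l ∉ S, s.arr 1 l ≤ s.arr 1 b) ∧
      s'.arr = s.arr ∧
      ∀ r, r ≠ 11 → r ≠ 13 → r ≠ 14 → r ≠ 15 → r ≠ 16 → s'.reg r = s.reg r) s τ := by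
  refine Wp.seq (Wp.const (by simp) (Wp.seq (Wp.const (by simp) (Wp.seq (Wp.const ?_ ?_)))))
  · simpa using hW
  refine Wp.for 6 (fun j s' =>
      (s'.reg 14 = -1 ∨ ∃ b : Fin n, b ∉ S ∧ s'.reg 13 = b ∧ s'.reg 14 = s.arr 1 b) ∧
      (∀ l : Fin n, (l : ℕ) < j → l ∉ S → s.arr 1 l ≤ s'.reg 14) ∧ s'.arr = s.arr ∧
      ∀ r, r ≠ 11 → r ≠ 13 → r ≠ 14 → r ≠ 15 → r ≠ 16 → s'.reg r = s.reg r)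
    (by decide) (by decide) hn (by simp) (by simpa using h0) (by simpa using h3) ?_ ?_ ?_
  · refine ⟨by simp, by simp, by simp, ?_⟩
    intro r h₁ h₂ h₃ _ _
    simp [h₁, h₂, h₃]
  · rintro j hj s₁ τ₁ hj₁ - h3' ⟨hb, hl, hA, hr⟩
    have h2' : s₁.reg 2 = 0 := by
      rw [hr 2 (by decide) (by decide) (by decide) (by decide) (by decide), h2]
    have hSj := hS ⟨j, hj⟩
    simp only at hSj
    have hyj0 := hy0 ⟨j, hj⟩
    have hyjD := hyD ⟨j, hj⟩
    simp only at hyj0 hyjD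
    refine Wp.seq (Wp.load j hj₁ (Wp.branch (fun hlt => ?_) (fun hge => ?_)))
    · have hjS : (⟨j, hj⟩ : Fin n) ∉ S := by
        intro h
        simp [hA, h3', hSj, h] at hlt
      refine Wp.seq (Wp.load j (by simpa using hj₁) (Wp.branch (fun hlt => ?_) (fun hge => ?_)))
      · simp [hA] at hlt
        refine Wp.seq (Wp.arith ?_ (Wp.arith ?_ ⟨by omega, by simp, by simp, by simp,
          Or.inr ⟨⟨j, hj⟩, hjS, ?_, ?_⟩, ?_, by simpa using hA, ?_⟩))
        · simp [Op.eval, hA, h2']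
          rw [abs_le]; omega
        · simp [Op.eval, hj₁, h2']
          omega
        · simp [Op.eval, hj₁, h2']
        · simp [Op.eval, hA, h2']
        · intro l hlj hlS
          simp only [State.setReg_reg, Op.eval, hA, h2', State.setReg_arr]
          simp
          by_cases hlj' : (l : ℕ) = j
          · rw [hlj']
          · exact (hl l (by omega) hlS).trans hlt.le
        · intro r h₁ h₂ h₃ h₄ h₅
          simp [h₁, h₂, h₃, h₄, h₅, hr r h₁ h₂ h₃ h₄ h₅]
      · simp [hA] at hge
        refine Wp.skip ⟨by omega, by simp, by simp, by simp, by simpa using hb, ?_,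
          by simpa using hA, ?_⟩
        · intro l hlj hlS
          simp
          by_cases hlj' : (l : ℕ) = j
          · rw [hlj']; exact hge
          · exact hl l (by omega) hlS
        · intro r h₁ h₂ h₃ h₄ h₅
          simp [h₁, h₄, h₅, hr r h₁ h₂ h₃ h₄ h₅]
    · have hjS : (⟨j, hj⟩ : Fin n) ∈ S := by
        by_contra h
        simp [hA, h3', hSj, h] at hge
      refine Wp.skip ⟨by omega, by simp, by simp, by simp, by simpa using hb, ?_,
        by simpa using hA, ?_⟩
      · intro l hlj hlS
        have hlj' : (l : ℕ) ≠ j := by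
          rintro rfl
          exact hlS hjS
        simpa using hl l (by omega) hlS
      · intro r h₁ h₂ h₃ h₄ h₅
        simp [h₁, h₄, hr r h₁ h₂ h₃ h₄ h₅]
  · rintro s' τ' hτ - - - ⟨hb, hl, hA, hr⟩
    refine ⟨by omega, ?_, hA, hr⟩
    -- The initial value `-1` lies below every coordinate, so it cannot survive while some `a ∉ S`
    -- exists.
    rcases hb with hb | ⟨b, hbS, h13, h14⟩
    · have := hl a a.2 ha
      have := hy0 a
      omega
    · exact ⟨b, hbS, h13, h14, fun l hlS => h14 ▸ hl l l.2 hlS⟩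

@[simp] theorem State.readSet_setReg (s : State) (x A : ℕ) (v : ℤ) :
    (s.setReg x v).readSet n A = s.readSet n A := rfl

/-- Projects register `17` onto `[0, D]`, where `D` stands in register `5`. -/
def clampProg : Prog :=
  .seq (.branch 17 2 (.arith .add 17 2 2) .skip) (.branch 5 17 (.arith .add 17 5 2) .skip)

theorem clampProg_spec {D : ℤ} (hD0 : 0 ≤ D) (hD : D ≤ W) (s : State) (τ : ℕ)
    (h2 : s.reg 2 = 0) (h5 : s.reg 5 = D) :
    Wp f T W clampProg (fun s' τ' => τ' ≤ τ + 4 ∧ s'.reg 17 = clamp D (s.reg 17) ∧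
      s'.arr = s.arr ∧ ∀ r ≠ 17, s'.reg r = s.reg r) s τ := by
  have hDW : |D| ≤ (W : ℤ) := by rwa [abs_of_nonneg hD0]
  refine Wp.seq (Wp.branch (fun h => Wp.arith (by simp [Op.eval, h2]) (Wp.branch (fun h' => ?_)
    fun h' => ?_)) fun h => Wp.skip (Wp.branch (fun h' => ?_) fun h' => ?_))
  · simp [Op.eval, h2, h5] at h'
    omega
  · refine Wp.skip ⟨by omega, ?_, rfl, fun r hr => by simp [hr]⟩
    simp only [State.setReg_reg, Op.eval, h2] at h ⊢
    simp only [clamp]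
    simp
    omega
  · refine Wp.arith (by simpa [Op.eval, h2, h5] using hDW)
      ⟨by omega, ?_, rfl, fun r hr => by simp [hr]⟩
    simp [Op.eval, h2, h5, clamp] at h h' ⊢
    omega
  · refine Wp.skip ⟨by omega, ?_, rfl, fun r hr => rfl⟩
    simp only [h2, h5, clamp] at h h' ⊢
    omega

/-- If register `15`, the value of the set in array `3`, is below register `8`, the best value
found so far, then that set becomes the best one. -/
def recordProg : Prog :=
  .branch 15 8 (.seq (.arith .add 8 15 2) copyProg) .skip

theorem recordProg_spec (hn : n ≤ W) (s : State) (τ : ℕ) (h0 : s.reg 0 = n) (h2 : s.reg 2 = 0)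
    (h3 : s.reg 3 = 1) (h15 : s.reg 15 = f (s.readSet n 3)) (h15W : |s.reg 15| ≤ (W : ℤ))
    (h8 : s.reg 8 = f (s.readSet n 0)) :
    Wp f T W recordProg (fun s' τ' => τ' ≤ τ + (4 * n + 4) ∧ s'.reg 8 = f (s'.readSet n 0) ∧
      s'.reg 8 ≤ s.reg 8 ∧ s'.reg 8 ≤ s.reg 15 ∧ (∀ A ≠ 0, s'.arr A = s.arr A) ∧
      ∀ r, r ≠ 8 → r ≠ 11 → r ≠ 15 → s'.reg r = s.reg r) s τ := by
  refine Wp.branch (fun h => Wp.seq (Wp.arith (by simpa [Op.eval, h2] using h15W) ?_))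
    fun h => Wp.skip ⟨by omega, h8, le_rfl, h, by simp, by simp⟩
  refine (copyProg_spec hn _ _ (by simpa using h0) (by simpa using h3)).mono ?_
  rintro s' τ' ⟨hτ, hc, hA, hr⟩
  have h8' : s'.reg 8 = s.reg 15 := by
    rw [hr 8 (by decide) (by decide)]
    simp [Op.eval, h2]
  refine ⟨by omega, ?_, by omega, by omega, by simpa using hA, ?_⟩
  · rw [h8', h15, State.readSet_congr (s' := s) (A := 0) (B := 3)]
    simpa using hc
  · intro r h₁ h₂ h₃
    simp [hr r h₂ h₃, h₁]

/-- Adds one more element to the greedy set in array `3` and updates the point in array `1`. -/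
def greedyProg : Prog :=
  .seq selectProg <| .seq (.store 3 13 3) <| .seq (.query 15 3) <| .seq (.arith .sub 16 15 12) <|
    .seq (.arith .add 12 15 2) <| .seq (.arith .sub 17 14 16) <| .seq clampProg <|
      .seq (.store 1 13 17) recordProg

/-- The values of `f` and the numbers up to `D + F` fit in a word. -/
structure WordBound (f : Finset (Fin n) → ℤ) (W : ℕ) (D F : ℤ) : Prop where
  n_le : n ≤ W
  value_le : ∀ S, |f S| ≤ (W : ℤ)
  one_le_F : 1 ≤ F
  D_nonneg : 0 ≤ D
  add_le : D + F ≤ W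

/-- The state before the element number `#S` is treated in a greedy step. -/
structure GreedyState (f : Finset (Fin n) → ℤ) (D F : ℤ) (y₀ : Fin n → ℤ) (S : Finset (Fin n))
    (s : State) : Prop where
  r2 : s.reg 2 = 0
  r5 : s.reg 5 = D
  hasInd : s.HasInd S
  prev : s.reg 12 = f S
  best : s.reg 8 = f (s.readSet n 0)
  inv : GreedyInv f D F (s.reg 8) y₀ (fun i => s.arr 1 i) S

/-- The point is overwritten in place. This does not disturb the greedy order, since coordinates
outside `S` still agree with `y₀`. -/
theorem greedyProg_spec (hf : IsSubmodular f) {D F : ℤ} (hW : WordBound f W D F)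
    (h₁ : ∀ i, f {i} - f ∅ ≤ F) (h₂ : ∀ i, f (Finset.univ.erase i) - f Finset.univ ≤ F)
    {y₀ : Fin n → ℤ} {S : Finset (Fin n)} {a : Fin n} (ha : a ∉ S) (s : State) (τ : ℕ)
    (h0 : s.reg 0 = n) (h3 : s.reg 3 = 1) (hs : GreedyState f D F y₀ S s) :
    Wp f T W greedyProg (fun s' τ' => τ' ≤ τ + (T + 12 * n + 17) ∧
      (∃ b ∉ S, GreedyState f D F y₀ (insert b S) s') ∧ s'.reg 8 ≤ s.reg 8 ∧
      ∀ r ≤ 10, r ≠ 8 → s'.reg r = s.reg r) s τ := by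
  have hWF := hW.one_le_F
  have hWD := hW.D_nonneg
  have hWa := hW.add_le
  refine Wp.seq ((selectProg_spec (D := D) hW.n_le (by omega) (by omega) s τ h0 hs.r2 h3
    hs.hasInd ha hs.inv.nonneg hs.inv.le).mono ?_)
  rintro s₁ τ₁ ⟨hτ₁, ⟨b, hb, h13, h14, hmax⟩, hA₁, hr₁⟩
  have hfr₁ : ∀ r ≤ 10, s₁.reg r = s.reg r := fun r hr =>
    hr₁ r (by omega) (by omega) (by omega) (by omega) (by omega)
  have h12 : s₁.reg 12 = f S := by
    rw [hr₁ 12 (by decide) (by decide) (by decide) (by decide) (by decide), hs.prev]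
  have h3' : s₁.reg 3 = 1 := by rw [hfr₁ 3 (by decide), h3]
  have h2' : s₁.reg 2 = 0 := by rw [hfr₁ 2 (by decide), hs.r2]
  have h5' : s₁.reg 5 = D := by rw [hfr₁ 5 (by decide), hs.r5]
  have hg := hf.abs_marginal_le h₁ h₂ hb
  refine Wp.seq (Wp.store b h13 ?_)
  set s₂ := s₁.setArr 3 b (s₁.reg 3) with hs₂
  have hind : s₂.HasInd (insert b S) := by
    refine hs.hasInd.insert (i := b) fun l => ?_
    simp [hs₂, h3', hA₁]
  refine Wp.seq (Wp.query _ hind.readSet_eq (hW.value_le _) ?_)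
  refine Wp.seq (Wp.arith ?_ (Wp.seq (Wp.arith ?_ (Wp.seq (Wp.arith ?_ ?_)))))
  · simp [Op.eval, hs₂, h12]
    rw [abs_le] at hg ⊢
    omega
  · simpa [Op.eval, hs₂, h2'] using hW.value_le _
  · simp [Op.eval, hs₂, h12, h14]
    have := hs.inv.nonneg b
    have := hs.inv.le b
    rw [abs_le] at hg ⊢
    omega
  set s₃ := State.setReg _ 17 _ with hs₃
  have hs₃8 : s₃.reg 8 = s.reg 8 := by simp [hs₃, hs₂, hfr₁ 8 (by decide)]
  have hs₃A : s₃.arr = s₂.arr := rfl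
  have hs₃r : ∀ r ≤ 10, s₃.reg r = s.reg r := by
    intro r hr
    simp [hs₃, hs₂, show r ≠ 17 by omega, show r ≠ 12 by omega, show r ≠ 16 by omega,
      show r ≠ 15 by omega, hfr₁ r hr]
  refine Wp.seq ((clampProg_spec hWD (by omega) s₃ _ (by rw [hs₃r 2 (by decide), hs.r2])
    (by rw [hs₃r 5 (by decide), hs.r5])).mono ?_)
  rintro s₄ τ₄ ⟨hτ₄, h17, hA₄, hr₄⟩
  have h17' : s₄.reg 17 = clamp D (s.arr 1 b - (f (insert b S) - f S)) := by
    rw [h17]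
    simp [hs₃, hs₂, Op.eval, h12, h14]
  have h13' : s₄.reg 13 = b := by
    rw [hr₄ 13 (by decide)]
    simp [hs₃, hs₂, h13]
  have h15' : s₄.reg 15 = f (insert b S) := by
    rw [hr₄ 15 (by decide)]
    simp [hs₃]
  have h12' : s₄.reg 12 = f (insert b S) := by
    rw [hr₄ 12 (by decide)]
    simp [hs₃, hs₂, Op.eval, h2']
  have hr₄' : ∀ r ≤ 10, s₄.reg r = s.reg r := fun r hr => by rw [hr₄ r (by omega), hs₃r r hr]
  refine Wp.seq (Wp.store b h13' ?_)
  have hind₄ : (s₄.setArr 1 b (s₄.reg 17)).HasInd (insert b S) := by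
    intro l
    simpa [hA₄, hs₃A] using hind l
  refine (recordProg_spec hW.n_le _ _ ?_ ?_ ?_ ?_ ?_ ?_).mono ?_
  · simp [hr₄' 0, h0]
  · simp [hr₄' 2, hs.r2]
  · simp [hr₄' 3, h3]
  · rw [hind₄.readSet_eq]
    simpa using h15'
  · simpa [h15'] using hW.value_le _
  · rw [State.setArr_reg, hr₄' 8 (by decide), hs.best]
    congr 1
    refine State.readSet_congr fun i _ => ?_
    simp [hA₄, hs₃A, hs₂, hA₁]
  · rintro s₅ τ₅ ⟨hτ₅, h8, h8s, h8v, hA₅, hr₅⟩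
    simp only [State.setArr_reg] at h8s h8v hr₅
    rw [hr₄' 8 (by decide)] at h8s
    have hr₅' : ∀ r ≤ 10, r ≠ 8 → s₅.reg r = s.reg r := fun r hr h => by
      rw [hr₅ r h (by omega) (by omega), hr₄' r hr]
    have hy : ∀ i : Fin n, s₅.arr 1 i = if i = b then s₄.reg 17 else s.arr 1 i := by
      intro i
      rw [hA₅ 1 (by decide)]
      simp [hA₄, hs₃A, hs₂, hA₁, Fin.val_inj]
    refine ⟨by omega, ⟨b, hb, ⟨?_, ?_, ?_, ?_, h8, ?_⟩⟩, h8s, hr₅'⟩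
    · rw [hr₅' 2 (by decide) (by decide), hs.r2]
    · rw [hr₅' 5 (by decide) (by decide), hs.r5]
    · intro l
      rw [hA₅ 3 (by decide)]
      exact hind₄ l
    · rw [hr₅ 12 (by decide) (by decide) (by decide), h12']
    · refine hs.inv.insert hf hb hg hmax h8s (by rw [← h15']; exact h8v) ?_ ?_
      · simp [hy, h17']
      · intro i hi
        simp [hy, hi]

/-! ### The descent loop. -/

/-- A step of the subgradient method. Register `7` holds the value of the empty set. -/
def stepProg : Prog :=
  .seq (fillProg 2) <| .seq (.arith .add 12 7 2) <| .seq (.const 10 0) (forProg 10 greedyProg)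

theorem stepProg_spec (hf : IsSubmodular f) {D F : ℤ} (hW : WordBound f W D F)
    (h₁ : ∀ i, f {i} - f ∅ ≤ F) (h₂ : ∀ i, f (Finset.univ.erase i) - f Finset.univ ≤ F)
    (s : State) (τ : ℕ) (h0 : s.reg 0 = n) (h2 : s.reg 2 = 0) (h3 : s.reg 3 = 1)
    (h5 : s.reg 5 = D) (h7 : s.reg 7 = f ∅) (h8 : s.reg 8 = f (s.readSet n 0))
    (h8' : s.reg 8 ≤ f ∅) (hy0 : ∀ i : Fin n, 0 ≤ s.arr 1 i) (hyD : ∀ i : Fin n, s.arr 1 i ≤ D) :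
    Wp f T W stepProg (fun s' τ' => τ' ≤ τ + (n * (T + 12 * n + 19) + (3 * n + 5)) ∧
      GreedyInv f D F (s'.reg 8) (fun i => s.arr 1 i) (fun i => s'.arr 1 i) Finset.univ ∧
      s'.reg 8 = f (s'.readSet n 0) ∧ s'.reg 8 ≤ s.reg 8 ∧
      ∀ r ≤ 9, r ≠ 8 → s'.reg r = s.reg r) s τ := by
  refine Wp.seq ((fillProg_spec hW.n_le 2 (by decide) s τ h0 h3).mono ?_)
  rintro s₁ τ₁ ⟨hτ₁, hf₁, hA₁, hr₁⟩
  refine Wp.seq (Wp.arith ?_ (Wp.seq (Wp.const (by simp) ?_)))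
  · simpa [Op.eval, hr₁, h2, h7] using hW.value_le ∅
  -- The order of the elements depends on the data, so the invariant fixes only the size of the
  -- processed set; size `n` forces the full set.
  refine Wp.for (T + 12 * n + 17) (fun j s' =>
    (∃ S : Finset (Fin n), S.card = j ∧ GreedyState f D F (fun i => s.arr 1 i) S s') ∧
      s'.reg 8 ≤ s.reg 8 ∧ ∀ r ≤ 9, r ≠ 8 → s'.reg r = s.reg r) (by decide) (by decide) hW.n_le
    (by simp) (by simp [hr₁, h0]) (by simp [hr₁, h3]) ?_ ?_ ?_
  · refine ⟨⟨∅, rfl, ?_, ?_, ?_, ?_, ?_, ?_⟩, ?_, ?_⟩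
    · simp [hr₁, h2]
    · simp [hr₁, h5]
    · intro i
      simp [hf₁ i i.2, h2]
    · simp [Op.eval, hr₁, h2, h7]
    · simp only [State.setReg_reg]
      rw [State.readSet_congr (s' := s) (A := 0) (B := 0)]
      · simpa [hr₁] using h8
      · simp [hA₁]
    · simp only [State.setReg_reg, State.setReg_arr]
      rw [hA₁ 1 (by decide)]
      simp only [hr₁ 8 (by decide)]
      exact GreedyInv.empty hy0 hyD (by simpa using h8')
    · simp [hr₁]
    · intro r hr h
      simp [show r ≠ 10 by omega, show r ≠ 12 by omega, hr₁ r (by omega)]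
  · rintro j hj s₂ τ₂ - h0' h3' ⟨⟨S, hS, hG⟩, h8s, hr⟩
    obtain ⟨a, ha⟩ : ∃ a, a ∉ S := by
      by_contra! h
      rw [Finset.eq_univ_iff_forall.mpr h, Finset.card_univ, Fintype.card_fin] at hS
      omega
    refine (greedyProg_spec hf hW h₁ h₂ ha s₂ τ₂ h0' h3' hG).mono ?_
    rintro s₃ τ₃ ⟨hτ₃, ⟨b, hb, hG'⟩, h8s', hr'⟩
    refine ⟨hτ₃, hr' 10 (by decide) (by decide), hr' 0 (by decide) (by decide),
      hr' 3 (by decide) (by decide), ⟨insert b S, ?_, ?_⟩, ?_, ?_⟩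
    · rw [Finset.card_insert_of_notMem hb, hS]
    · obtain ⟨a1, a2, a3, a4, a5, a6⟩ := hG'
      exact ⟨by simpa using a1, by simpa using a2, a3, by simpa using a4, by simpa using a5,
        by simpa using a6⟩
    · simpa using h8s'.trans h8s
    · intro r h₁ h₂
      simp [show r ≠ 10 by omega, hr' r (by omega) h₂, hr r h₁ h₂]
  · rintro s' τ' hτ - - - ⟨⟨S, hS, hG⟩, h8s, hr⟩
    rw [show T + 12 * n + 17 + 2 = T + 12 * n + 19 from rfl] at hτ
    obtain rfl : S = Finset.univ := by
      rw [← Finset.card_eq_iff_eq_univ, hS, Fintype.card_fin]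
    exact ⟨by omega, hG.inv, hG.best, h8s, hr⟩

/-- The subgradient method with `N` steps, where `N` stands in register `6`. -/
def descentProg : Prog := .loop 9 6 (.seq stepProg (.arith .add 9 9 3))

theorem descentProg_spec (hf : IsSubmodular f) {D F : ℤ} (hW : WordBound f W D F)
    (h₁ : ∀ i, f {i} - f ∅ ≤ F) (h₂ : ∀ i, f (Finset.univ.erase i) - f Finset.univ ≤ F)
    {m N : ℕ} (hD : n * F ^ 2 ≤ D * (m + 1)) (hD0 : 0 < D) (hN : n * D < N * (m + 1)) (hNW : N ≤ W)
    (s : State) (τ : ℕ) (h0 : s.reg 0 = n) (h2 : s.reg 2 = 0) (h3 : s.reg 3 = 1)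
    (h5 : s.reg 5 = D) (h6 : s.reg 6 = N) (h7 : s.reg 7 = f ∅) (h8 : s.reg 8 = f ∅)
    (h9 : s.reg 9 = 0) (hA0 : ∀ i, s.arr 0 i = 0) (hA1 : ∀ i, s.arr 1 i = 0) :
    Wp f T W descentProg (fun s' τ' =>
      τ' ≤ τ + N * (n * (T + 12 * n + 19) + (3 * n + 7)) + 1 ∧
      ∀ A, f (s'.readSet n 0) ≤ f A + m) s τ := by
  refine Wp.loop N (n * (T + 12 * n + 19) + (3 * n + 6)) (fun t s' =>
    s'.reg 9 = t ∧ (∀ r ≤ 7, s'.reg r = s.reg r) ∧ s'.reg 8 = f (s'.readSet n 0) ∧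
    s'.reg 8 ≤ f ∅ ∧ (∀ i : Fin n, 0 ≤ s'.arr 1 i) ∧ (∀ i : Fin n, s'.arr 1 i ≤ D) ∧
    ∀ A, f A + m < s'.reg 8 →
      ∑ i : Fin n, (s'.arr 1 i - scaledInd D A i) ^ 2 ≤ n * D ^ 2 - t * (D * (m + 1)))
    ?_ ?_ ?_ ?_
  · refine ⟨by simpa using h9, by simp, ?_, h8.le, by simp [hA1], by simp [hA1, hD0.le], ?_⟩
    · rw [h8]
      congr 1
      ext i
      simp [State.readSet, hA0]
    · intro A _
      simpa [hA1] using sum_sq_scaledInd_le D A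
  · rintro t ht s₁ τ₁ ⟨h9, hr, h8, h8', hy0, hyD, hpot⟩
    refine ⟨by rw [h9, hr 6 (by decide), h6]; exact_mod_cast ht, Wp.seq ?_⟩
    refine (stepProg_spec hf hW h₁ h₂ s₁ τ₁ ?_ ?_ ?_ ?_ ?_ h8 h8' hy0 hyD).mono ?_
    · rw [hr 0 (by decide), h0]
    · rw [hr 2 (by decide), h2]
    · rw [hr 3 (by decide), h3]
    · rw [hr 5 (by decide), h5]
    · rw [hr 7 (by decide), h7]
    · rintro s₂ τ₂ ⟨hτ₂, hG, hb, hbs, hr₂⟩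
      have h9' : s₂.reg 9 = t := by rw [hr₂ 9 (by decide) (by decide), h9]
      have h3' : s₂.reg 3 = 1 := by
        rw [hr₂ 3 (by decide) (by decide), hr 3 (by decide), h3]
      refine Wp.arith ?_ ⟨by omega, ?_, ?_, ?_, ?_, ?_, ?_, ?_⟩
      · simp only [Op.eval, h9', h3']
        rw [abs_le]
        omega
      · simp [Op.eval, h9', h3']
      · intro r hr'
        simp [show r ≠ 9 by omega, hr₂ r (by omega) (by omega), hr r hr']
      · simpa using hb
      · simpa using hbs.trans h8'
      · simpa using hG.nonneg
      · simpa using hG.le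
      · intro A hA
        simp only [State.setReg_reg, State.setReg_arr] at hA ⊢
        have hA' : f A + m < s₂.reg 8 := by simpa using hA
        have := hG.potential_decrease hD0.le hy0 hD hA'
        -- The best value never increases, so a set that beats the new one by more than `m` also
        -- beat the old one.
        have := hpot A (by omega)
        push_cast
        linarith
  · rintro s' ⟨h9, hr, -⟩
    rw [h9, hr 6 (by decide), h6]
  · rintro s' τ' hτ ⟨-, -, h8, -, -, -, hpot⟩
    refine ⟨by omega, fun A => ?_⟩
    by_contra! hlt
    have hp := hpot A (by rw [h8]; exact hlt)
    have h0' : 0 ≤ ∑ i : Fin n, (s'.arr 1 i - scaledInd D A i) ^ 2 :=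
      Finset.sum_nonneg fun i _ => sq_nonneg _
    -- A set still better by more than `m` would have potential at most `nD² - ND(m + 1) < 0`.
    nlinarith [mul_lt_mul_of_pos_left hN hD0]

/-! ### Computing a bound for the marginals. -/

/-- Raises register `4` to the largest increase of `f` over the value in register `r` that is
obtained by changing one cell of array `3` from the value of register `z` to that of
register `y`. -/
def marginProg (y z r : ℕ) : Prog :=
  .seq (.const 11 0) <| forProg 11 <| .seq (.store 3 11 y) <| .seq (.query 15 3) <|
    .seq (.store 3 11 z) <| .seq (.arith .sub 16 15 r) <| .branch 4 16 (.arith .add 4 16 2) .skip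

/-- One program serves both ends of the cube: `G i` is `B` with `i` inserted or with `i` deleted,
according to which of `y` and `z` holds `1`. The bound `K` records that register `4` does not
overshoot, which the running time needs. -/
theorem marginProg_spec {y z r : ℕ} (hy : y < 4) (hz : z < 4) (hr4 : r ≠ 4) (hr10 : r ≤ 10)
    (hn : n ≤ W) (hW : ∀ S, |f S| ≤ (W : ℤ)) (hW' : ∀ S U, |f S - f U| ≤ (W : ℤ))
    {B : Finset (Fin n)} {G : Fin n → Finset (Fin n)} (s : State) (τ : ℕ)
    (hset : ∀ (i : Fin n) (s' : State), s'.HasInd B → (s'.setArr 3 i (s.reg y)).HasInd (G i))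
    (hback : ∀ (i : Fin n) (s' : State), s'.HasInd (G i) → (s'.setArr 3 i (s.reg z)).HasInd B)
    (h0 : s.reg 0 = n) (h2 : s.reg 2 = 0) (h3 : s.reg 3 = 1) (hB : s.HasInd B)
    (hr : s.reg r = f B) {K : ℤ} (hK : s.reg 4 ≤ K) (hKG : ∀ i, f (G i) - f B ≤ K) :
    Wp f T W (marginProg y z r) (fun s' τ' => τ' ≤ τ + (n * (T + 7) + 2) ∧ s'.HasInd B ∧
      s.reg 4 ≤ s'.reg 4 ∧ (∀ i, f (G i) - f B ≤ s'.reg 4) ∧ s'.reg 4 ≤ K ∧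
      (∀ A ≠ 3, s'.arr A = s.arr A) ∧ ∀ x ≤ 10, x ≠ 4 → s'.reg x = s.reg x) s τ := by
  refine Wp.seq (Wp.const (by simp) ?_)
  refine Wp.for (T + 5) (fun j s' => s'.HasInd B ∧ s.reg 4 ≤ s'.reg 4 ∧
      (∀ i : Fin n, (i : ℕ) < j → f (G i) - f B ≤ s'.reg 4) ∧ s'.reg 4 ≤ K ∧
      (∀ A ≠ 3, s'.arr A = s.arr A) ∧ ∀ x ≤ 10, x ≠ 4 → s'.reg x = s.reg x)
    (by decide) (by decide) hn (by simp) (by simpa using h0) (by simpa using h3) ?_ ?_ ?_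
  · refine ⟨hB, by simp, by simp, by simpa using hK, by simp, ?_⟩
    intro x hx _
    simp [show x ≠ 11 by omega]
  · rintro j hj s₁ τ₁ hj₁ - - ⟨hB₁, h4, hG, h4K, hA, hx⟩
    refine Wp.seq (Wp.store j hj₁ ?_)
    have hS : (s₁.setArr 3 j (s₁.reg y)).HasInd (G ⟨j, hj⟩) := by
      rw [hx y (by omega) (by omega)]
      exact hset ⟨j, hj⟩ s₁ hB₁
    refine Wp.seq (Wp.query _ hS.readSet_eq (hW _) (Wp.seq (Wp.store j (by simpa using hj₁) ?_)))
    set s₂ := State.setArr _ 3 j _ with hs₂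
    have hB₂ : s₂.HasInd B := by
      rw [hs₂]
      simp only [State.setReg_reg, show z ≠ 15 by omega, if_false, State.setArr_reg]
      rw [hx z (by omega) (by omega)]
      exact hback ⟨j, hj⟩ _ hS
    have hr₂ : s₂.reg r = f B := by simp [hs₂, show r ≠ 15 by omega, hx r hr10 hr4, hr]
    have h15 : s₂.reg 15 = f (G ⟨j, hj⟩) := by simp [hs₂]
    have hx₂ : ∀ x ≤ 11, s₂.reg x = s₁.reg x := by
      intro x h
      simp [hs₂, show x ≠ 15 by omega]
    have hA₂ : ∀ A ≠ 3, s₂.arr A = s.arr A := by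
      intro A h
      ext i
      simp [hs₂, h, hA A h]
    refine Wp.seq (Wp.arith (by simpa [Op.eval, hr₂, h15] using hW' _ _) ?_)
    refine Wp.branch (fun h => Wp.arith ?_ ⟨by omega, by simp [hx₂], by simp [hx₂], by simp [hx₂],
      hB₂, ?_, ?_, ?_, hA₂, ?_⟩) fun h => Wp.skip ⟨by omega, by simp [hx₂], by simp [hx₂],
      by simp [hx₂], hB₂, ?_, ?_, ?_, hA₂, ?_⟩
    · simpa [Op.eval, hr₂, h15, hx₂, hx 2, h2] using hW' _ _
    · simp [Op.eval, hr₂, h15, hx₂, hx 2, h2] at h ⊢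
      omega
    · intro i hi
      simp [Op.eval, hr₂, h15, hx₂, hx 2, h2] at h ⊢
      by_cases hij : (i : ℕ) = j
      · obtain rfl : i = ⟨j, hj⟩ := Fin.ext hij
        linarith
      · have := hG i (by omega)
        omega
    · simpa [Op.eval, hr₂, h15, hx₂, hx 2, h2] using hKG ⟨j, hj⟩
    · intro x h h'
      simp [h', show x ≠ 11 by omega, show x ≠ 16 by omega, hx₂ x (by omega), hx x h h']
    · simpa [hx₂] using h4
    · intro i hi
      simp [Op.eval, hr₂, h15, hx₂] at h ⊢
      by_cases hij : (i : ℕ) = j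
      · obtain rfl : i = ⟨j, hj⟩ := Fin.ext hij
        linarith
      · have := hG i (by omega)
        omega
    · simpa [hx₂] using h4K
    · intro x h h'
      simp [show x ≠ 11 by omega, show x ≠ 16 by omega, hx₂ x (by omega), hx x h h']
  · rintro s' τ' hτ - - - ⟨h₁, h₂, h₃, h₄, h₅, h₆⟩
    rw [show T + 5 + 2 = T + 7 from rfl] at hτ
    exact ⟨by omega, h₁, h₂, fun i => h₃ i i.2, h₄, h₅, h₆⟩

/-- Puts an upper bound of the marginal differences into register `4`, and the value of the
empty set into registers `7` and `8`. -/
def boundProg : Prog :=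
  .seq (.const 3 1) <| .seq (.const 4 1) <| .seq (.query 7 3) <| .seq (marginProg 3 2 7) <|
    .seq (fillProg 3) <| .seq (.query 8 3) <| .seq (marginProg 2 3 8) (.arith .add 8 7 2)

/-- Register `4` starts at `1`, which covers constant `f`. It ends large enough for
`IsSubmodular.abs_marginal_le`, yet at most the `F` of the time bound. -/
theorem boundProg_spec (hn : n ≤ W) (hW1 : 1 ≤ W) (hW : ∀ S, |f S| ≤ (W : ℤ))
    (hW' : ∀ S U, |f S - f U| ≤ (W : ℤ)) (m : ℕ) (τ : ℕ) :
    Wp f T W boundProg (fun s τ' => τ' ≤ τ + (2 * (n * (T + 7)) + 2 * T + 3 * n + 9) ∧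
      s.reg 0 = n ∧ s.reg 1 = m ∧ s.reg 2 = 0 ∧ s.reg 3 = 1 ∧ s.reg 7 = f ∅ ∧ s.reg 8 = f ∅ ∧
      s.reg 9 = 0 ∧ (∀ i, s.arr 0 i = 0) ∧ (∀ i, s.arr 1 i = 0) ∧ 1 ≤ s.reg 4 ∧
      s.reg 4 ≤ (max 1 (maxMarginal f) : ℕ) ∧ (∀ i, f {i} - f ∅ ≤ s.reg 4) ∧
      ∀ i, f (Finset.univ.erase i) - f Finset.univ ≤ s.reg 4) (State.init n m) τ := by
  have hK₁ : ∀ i, f {i} - f ∅ ≤ (max 1 (maxMarginal f) : ℕ) := fun i => by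
    have h := abs_sub_erase_le_maxMarginal f (Finset.mem_singleton_self i)
    rw [Finset.erase_singleton, abs_le] at h
    omega
  have hK₂ : ∀ i, f (Finset.univ.erase i) - f Finset.univ ≤ (max 1 (maxMarginal f) : ℕ) := by
    intro i
    have h := abs_sub_erase_le_maxMarginal f (Finset.mem_univ i)
    rw [abs_le] at h
    omega
  refine Wp.seq (Wp.const (by simpa using hW1) (Wp.seq (Wp.const (by simpa using hW1) (Wp.seq ?_))))
  set s₀ := State.setReg _ 4 1 with hs₀
  -- All arrays are initially zero, so the first query already reads the empty set.
  have hind₀ : s₀.HasInd (∅ : Finset (Fin n)) := by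
    intro i
    simp [hs₀, State.init]
  refine Wp.query _ hind₀.readSet_eq (hW _) (Wp.seq ?_)
  refine (marginProg_spec (y := 3) (z := 2) (r := 7) (G := fun i => {i}) (by decide)
    (by decide) (by decide) (by decide) hn hW hW' (s₀.setReg 7 (f ∅)) _ ?_ ?_ ?_ ?_ ?_ hind₀ ?_ ?_ hK₁).mono ?_
  · intro i s' hs'
    refine hs'.insert (i := i) fun l => ?_
    simp [hs₀]
  · intro i s' hs'
    have := hs'.erase (i := i) (s' := s'.setArr 3 i 0) fun l => by simp
    simpa [hs₀, State.init] using this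
  · simp [hs₀, State.init]
  · simp [hs₀, State.init]
  · simp [hs₀, State.init]
  · simp
  · simp [hs₀]
  rintro s₁ τ₁ ⟨hτ₁, -, h4₁, hG₁, hK₁', hA₁, hx₁⟩
  have h7₁ : s₁.reg 7 = f ∅ := by simp [hx₁]
  replace hx₁ : ∀ x ≤ 10, x ≠ 4 → x ≠ 7 → s₁.reg x = s₀.reg x := fun x h h' h'' => by
    simp [hx₁ x h h', h'']
  have h4₁' : 1 ≤ s₁.reg 4 := by simpa [hs₀] using h4₁
  refine Wp.seq ((fillProg_spec hn 3 (by decide) s₁ τ₁ ?_ ?_).mono ?_)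
  · simp [hx₁, hs₀, State.init]
  · simp [hx₁, hs₀, State.init]
  rintro s₂ τ₂ ⟨hτ₂, hf₂, hA₂, hx₂⟩
  have h3₂ : s₂.reg 3 = 1 := by simp [hx₁, hx₂, hs₀, State.init]
  have h2₂ : s₂.reg 2 = 0 := by simp [hx₁, hx₂, hs₀, State.init]
  have hind₂ : s₂.HasInd (Finset.univ : Finset (Fin n)) := by
    intro i
    simp [hf₂ i i.2, hx₁, hs₀]
  refine Wp.seq (Wp.query _ hind₂.readSet_eq (hW _) (Wp.seq ?_))
  refine (marginProg_spec (y := 2) (z := 3) (r := 8) (G := fun i => Finset.univ.erase i) (by decide)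
    (by decide) (by decide) (by decide) hn hW hW' (s₂.setReg 8 (f Finset.univ))
    _ ?_ ?_ ?_ ?_ ?_ hind₂ ?_ ?_ hK₂).mono ?_
  · intro i s' hs'
    refine hs'.erase (i := i) fun l => ?_
    simp [h2₂]
  · intro i s' hs'
    have := hs'.insert (i := i) (s' := s'.setArr 3 i 1) fun l => by simp
    simpa [h3₂, Finset.insert_erase] using this
  · simp [hx₂, hx₁, hs₀, State.init]
  · simp [h2₂]
  · simp [h3₂]
  · simp
  · simpa [hx₂] using hK₁'
  rintro s₃ τ₃ ⟨hτ₃, -, h4₃, hG₃, hK₃, hA₃, hx₃⟩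
  replace hx₃ : ∀ x ≤ 10, x ≠ 4 → x ≠ 8 → s₃.reg x = s₂.reg x := fun x h h' h'' => by
    simp [hx₃ x h h', h'']
  have h7₃ : s₃.reg 7 = f ∅ := by simp [hx₃, hx₂, h7₁]
  have h4₃' : s₁.reg 4 ≤ s₃.reg 4 := by simpa [hx₂] using h4₃
  have h2₃ : s₃.reg 2 = 0 := by simp [hx₃, h2₂]
  refine Wp.arith ?_ ⟨by omega, ?_, ?_, ?_, ?_, ?_, ?_, ?_, ?_, ?_, ?_, ?_, ?_, ?_⟩
  · simpa [Op.eval, h7₃, h2₃] using hW _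
  · simp [hx₃, hx₂, hx₁, hs₀, State.init]
  · simp [hx₃, hx₂, hx₁, hs₀, State.init]
  · simp [h2₃]
  · simp [hx₃, h3₂]
  · simp [h7₃]
  · simp [Op.eval, h7₃, h2₃]
  · simp [hx₃, hx₂, hx₁, hs₀, State.init]
  · simp [hA₃, hA₂, hA₁, hs₀, State.init]
  · simp [hA₃, hA₂, hA₁, hs₀, State.init]
  · simpa using h4₁'.trans h4₃'
  · simpa using hK₃
  · intro i
    simpa using (hG₁ i).trans h4₃'
  · simpa using hG₃

/-! ### Parameters, running time and word size. -/

/-- The bound of the coordinates in the subgradient method. -/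
def boxSize (n m F : ℕ) : ℕ := F * F * n / (m + 1) + 1

/-- The number of steps of the subgradient method. -/
def stepCount (n m F : ℕ) : ℕ := n * boxSize n m F / (m + 1) + 1

/-- Puts `boxSize n m F` and `stepCount n m F` into the registers `5` and `6`. -/
def paramProg : Prog :=
  .seq (.arith .mul 5 4 4) <| .seq (.arith .mul 5 5 0) <| .seq (.arith .add 17 1 3) <|
    .seq (.arith .div 5 5 17) <| .seq (.arith .add 5 5 3) <| .seq (.arith .mul 6 0 5) <|
    .seq (.arith .div 6 6 17) (.arith .add 6 6 3)

theorem paramProg_spec {m F : ℕ} (hn : 1 ≤ n) (hm : m + 1 ≤ W) (hW₁ : F * F * n + 1 ≤ W)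
    (hW₂ : n * (F * F * n + 1) + 1 ≤ W) (s : State) (τ : ℕ) (h0 : s.reg 0 = n)
    (h1 : s.reg 1 = m) (h3 : s.reg 3 = 1) (h4 : s.reg 4 = F) :
    Wp f T W paramProg (fun s' τ' => τ' ≤ τ + 8 ∧ s'.reg 5 = boxSize n m F ∧
      s'.reg 6 = stepCount n m F ∧ s'.arr = s.arr ∧
      ∀ r, r ≠ 5 → r ≠ 6 → r ≠ 17 → s'.reg r = s.reg r) s τ := by
  have hdiv : F * F * n / (m + 1) ≤ F * F * n := Nat.div_le_self _ _
  have hdiv2 : n * boxSize n m F / (m + 1) ≤ n * boxSize n m F := Nat.div_le_self _ _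
  have hbox : boxSize n m F ≤ F * F * n + 1 := by unfold boxSize; omega
  have hbox2 : n * boxSize n m F ≤ n * (F * F * n + 1) := Nat.mul_le_mul_left _ hbox
  have hFF : F * F ≤ F * F * n := Nat.le_mul_of_pos_right _ hn
  have habs : ∀ a : ℕ, a ≤ W → |(a : ℤ)| ≤ (W : ℤ) := fun a ha => by
    rw [abs_of_nonneg (by positivity)]; exact_mod_cast ha
  -- Each machine operation is identified with one on natural numbers, so that the word bounds
  -- become inequalities in `ℕ`.
  have e1 : (Op.mul.eval (F : ℤ) F) = ((F * F : ℕ) : ℤ) := by simp [Op.eval]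
  have e2 : (Op.mul.eval ((F * F : ℕ) : ℤ) n) = ((F * F * n : ℕ) : ℤ) := by simp [Op.eval]
  have e3 : (Op.add.eval (m : ℤ) 1) = ((m + 1 : ℕ) : ℤ) := by simp [Op.eval]
  have e4 : (Op.div.eval ((F * F * n : ℕ) : ℤ) ((m + 1 : ℕ) : ℤ)) =
    ((F * F * n / (m + 1) : ℕ) : ℤ) := by simp [Op.eval]
  have e5 : (Op.add.eval ((F * F * n / (m + 1) : ℕ) : ℤ) 1) = (boxSize n m F : ℤ) := by
    simp [Op.eval, boxSize]
  have e6 : (Op.mul.eval (n : ℤ) (boxSize n m F)) = ((n * boxSize n m F : ℕ) : ℤ) := by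
    simp [Op.eval]
  have e7 : (Op.div.eval ((n * boxSize n m F : ℕ) : ℤ) ((m + 1 : ℕ) : ℤ)) =
    ((n * boxSize n m F / (m + 1) : ℕ) : ℤ) := by simp [Op.eval]
  have e8 : (Op.add.eval ((n * boxSize n m F / (m + 1) : ℕ) : ℤ) 1) = (stepCount n m F : ℤ) := by
    simp [Op.eval, stepCount]
  refine Wp.seq (Wp.arith ?_ (Wp.seq (Wp.arith ?_ (Wp.seq (Wp.arith ?_ (Wp.seq (Wp.arith ?_
    (Wp.seq (Wp.arith ?_ (Wp.seq (Wp.arith ?_ (Wp.seq (Wp.arith ?_ (Wp.arith ?_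
      ⟨by omega, ?_, ?_, rfl, ?_⟩))))))))))))))
  on_goal 11 =>
    intro r h₅ h₆ h₁₇
    simp only [State.setReg_reg, h₅, h₆, h₁₇, if_false]
  all_goals simp only [State.setReg_reg, h4, h0, h1, h3, e1, e2, e3, e4, e5, e6, e7, e8,
    reduceIte, Nat.reduceEqDiff]
  all_goals refine habs _ ?_
  all_goals first | omega | (unfold stepCount; omega)

/-- Submodular minimization by the subgradient method in integer arithmetic. -/
def minimizeProg : Prog := .seq boundProg (.seq paramProg descentProg)

/-- `F` is the value that the program computes, known only to be at most `max 1 (maxMarginal f)`;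
hence the word bounds are required for all such values. -/
theorem minimizeProg_spec (hf : IsSubmodular f) (hn1 : 1 ≤ n) (hn : n ≤ W)
    (hW : ∀ S, |f S| ≤ (W : ℤ)) (hW' : ∀ S U, |f S - f U| ≤ (W : ℤ)) {m : ℕ} (hm : m + 1 ≤ W)
    (hF : ∀ F ≤ max 1 (maxMarginal f), F * F * n + 1 + F ≤ W ∧ n * (F * F * n + 1) + 1 ≤ W) :
    ∃ F ≤ max 1 (maxMarginal f),
    Wp f T W minimizeProg (fun s τ => τ ≤ 2 * (n * (T + 7)) + 2 * T + 3 * n + 18 +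
        stepCount n m F * (n * (T + 12 * n + 19) + (3 * n + 7)) ∧
      ∀ A, f (s.readSet n 0) ≤ f A + m) (State.init n m) 0 := by
  obtain ⟨s, t, hex, hτ, h0, h1, h2, h3, h7, h8, h9, hA0, hA1, hF1, hFK, hm1, hm2⟩ :=
    boundProg_spec (T := T) hn (by omega) hW hW' m 0
  obtain ⟨F, hF4⟩ : ∃ F : ℕ, s.reg 4 = F := ⟨(s.reg 4).toNat, by omega⟩
  rw [hF4] at hF1 hFK hm1 hm2
  have hFle : F ≤ max 1 (maxMarginal f) := by exact_mod_cast hFK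
  obtain ⟨hW1, hW2⟩ := hF F hFle
  refine ⟨F, hFle, Wp.seq ⟨s, t, hex, Wp.seq ?_⟩⟩
  have hdiv : F * F * n / (m + 1) ≤ F * F * n := Nat.div_le_self _ _
  have hdiv2 : n * boxSize n m F / (m + 1) ≤ n * boxSize n m F := Nat.div_le_self _ _
  have hbox : boxSize n m F ≤ F * F * n + 1 := by unfold boxSize; omega
  have hbox2 : n * boxSize n m F ≤ n * (F * F * n + 1) := Nat.mul_le_mul_left _ hbox
  -- The `+ 1` in `boxSize` and in `stepCount` offsets the rounding of the divisions; in `hN` it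
  -- makes the inequality strict.
  have hD : n * F ^ 2 ≤ boxSize n m F * (m + 1) := by
    have := Nat.lt_div_mul_add (a := F * F * n) (b := m + 1) (by omega)
    unfold boxSize
    nlinarith
  have hN : n * boxSize n m F < stepCount n m F * (m + 1) := by
    have := Nat.lt_div_mul_add (a := n * boxSize n m F) (b := m + 1) (by omega)
    unfold stepCount
    nlinarith
  refine (paramProg_spec hn1 hm (by omega) hW2 s _ h0 h1 h3 hF4).mono ?_
  rintro s₁ τ₁ ⟨hτ₁, h5', h6', hA, hr⟩
  refine (descentProg_spec (D := boxSize n m F) (F := F) (m := m) (N := stepCount n m F) hf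
    ⟨hn, hW, hF1, by positivity, ?_⟩ hm1 hm2 (by exact_mod_cast hD)
    (by unfold boxSize; positivity) (by exact_mod_cast hN) (by unfold stepCount; omega) _ _
    ?_ ?_ ?_ h5' h6' ?_ ?_ ?_ ?_ ?_).mono ?_
  · norm_cast
    omega
  any_goals simp [hr, hA, h0, h2, h3, h7, h8, h9, hA0, hA1]
  rintro s' τ' hτ' h
  exact ⟨by omega, h⟩

/-- As `T ≥ 1` and `n ≥ 1`, every lower-order term, including the bookkeeping of order `n²` in each
step, is absorbed by `n²T`. -/
theorem runTime_le {n T m F : ℕ} (hn : 1 ≤ n) (hT : 1 ≤ T) :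
    2 * (n * (T + 7)) + 2 * T + 3 * n + 18 +
        stepCount n m F * (n * (T + 12 * n + 19) + (3 * n + 7)) ≤
      130 * (stepCount n m F * (n ^ 2 * T)) := by
  have hnT : n * T ≤ n ^ 2 * T := Nat.mul_le_mul_right _ (Nat.le_self_pow two_ne_zero n)
  have h1 : 1 ≤ n * T := Nat.mul_pos hn hT
  have h2 : n ≤ n * T := Nat.le_mul_of_pos_right _ hT
  have h3 : T ≤ n * T := Nat.le_mul_of_pos_left _ hn
  have h4 : n ^ 2 ≤ n ^ 2 * T := Nat.le_mul_of_pos_right _ hT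
  have h5 : n * (T + 12 * n + 19) + (3 * n + 7) ≤ 50 * (n ^ 2 * T) := by
    have : n * (T + 12 * n + 19) = n * T + 12 * n ^ 2 + 19 * n := by ring
    omega
  have h6 : 2 * (n * (T + 7)) + 2 * T + 3 * n + 18 ≤ 50 * (n ^ 2 * T) := by
    have : n * (T + 7) = n * T + 7 * n := by ring
    omega
  have h7 : 1 ≤ stepCount n m F := Nat.le_add_left _ _
  have h8 := Nat.mul_le_mul_left (stepCount n m F) h5
  have h9 : n ^ 2 * T ≤ stepCount n m F * (n ^ 2 * T) := Nat.le_mul_of_pos_left _ h7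
  have h10 : stepCount n m F * (50 * (n ^ 2 * T)) = 50 * (stepCount n m F * (n ^ 2 * T)) := by ring
  omega

/-- With `x = n/k ≥ 1` the count is at most `x²M² + x + 1`. The last two terms come from rounding
up, and each is at most the first. -/
theorem stepCount_le {n m F M : ℕ} (hM : 1 ≤ M) (hF : F ≤ M) {k : ℝ} (hk : 0 < k)
    (hkm : k ≤ m + 1) (hkn : k ≤ n) :
    (stepCount n m F : ℝ) ≤ 3 * ((n : ℝ) ^ 2 * (M : ℝ) ^ 2 / k ^ 2) := by
  have hm : (0 : ℝ) < m + 1 := by positivity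
  have h1 : (boxSize n m F : ℝ) ≤ (n : ℝ) * (M : ℝ) ^ 2 / k + 1 := by
    unfold boxSize
    push_cast
    gcongr
    refine Nat.cast_div_le.trans ?_
    push_cast
    rw [show (F : ℝ) * F * n = n * F ^ 2 by ring]
    gcongr
  have h2 : (stepCount n m F : ℝ) ≤ n * ((n : ℝ) * (M : ℝ) ^ 2 / k + 1) / k + 1 := by
    unfold stepCount
    push_cast
    gcongr
    refine Nat.cast_div_le.trans ?_
    push_cast
    gcongr
  have h3 : 1 ≤ (n : ℝ) / k := (one_le_div hk).mpr hkn
  have h4 : (1 : ℝ) ≤ (M : ℝ) ^ 2 := by exact_mod_cast Nat.one_le_pow _ _ hM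
  have h5 : (n : ℝ) ^ 2 * (M : ℝ) ^ 2 / k ^ 2 = ((n : ℝ) / k) ^ 2 * (M : ℝ) ^ 2 := by
    field_simp
  have h6 : n * ((n : ℝ) * (M : ℝ) ^ 2 / k + 1) / k =
      ((n : ℝ) / k) ^ 2 * (M : ℝ) ^ 2 + (n : ℝ) / k := by
    field_simp
  have h7 : (n : ℝ) / k ≤ ((n : ℝ) / k) ^ 2 * (M : ℝ) ^ 2 := by
    calc (n : ℝ) / k ≤ ((n : ℝ) / k) ^ 2 := le_self_pow₀ h3 two_ne_zero
      _ ≤ _ := le_mul_of_one_le_right (by positivity) h4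
  rw [h5]
  linarith

/-- With `b = n + a + 2`, one has `F ≤ b²`, `F²n ≤ b⁵` and `n(F²n + 1) ≤ b⁷`. Since `b ≥ 2`, passing
to the next power leaves room for each addition, whence the exponent `8`. -/
theorem wordSize_bounds {n a F : ℕ} (hF : F ≤ max 1 (2 * a)) :
    n + 1 ≤ (n + a + 2) ^ 8 ∧ 2 * a ≤ (n + a + 2) ^ 8 ∧
      F * F * n + 1 + F ≤ (n + a + 2) ^ 8 ∧ n * (F * F * n + 1) + 1 ≤ (n + a + 2) ^ 8 := by
  obtain ⟨b, hb⟩ : ∃ b, b = n + a + 2 := ⟨_, rfl⟩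
  rw [← hb]
  have hb2 : 2 ≤ b := by omega
  have hstep : ∀ k, 2 * b ^ k ≤ b ^ (k + 1) := fun k => by
    rw [pow_succ']; exact Nat.mul_le_mul_right _ hb2
  have hpos : ∀ k, 1 ≤ b ^ k := fun k => Nat.one_le_pow _ _ (by omega)
  have h1 : 2 * b ^ 1 ≤ b ^ 2 := hstep 1
  have h2 : 2 * b ^ 2 ≤ b ^ 3 := hstep 2
  have h3 : 2 * b ^ 3 ≤ b ^ 4 := hstep 3
  have h4 : 2 * b ^ 4 ≤ b ^ 5 := hstep 4
  have h5 : 2 * b ^ 5 ≤ b ^ 6 := hstep 5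
  have h6 : 2 * b ^ 6 ≤ b ^ 7 := hstep 6
  have h7 : 2 * b ^ 7 ≤ b ^ 8 := hstep 7
  rw [pow_one] at h1
  have hF2 : F ≤ b ^ 2 := by omega
  have hFF : F * F * n ≤ b ^ 5 :=
    (Nat.mul_le_mul (Nat.mul_le_mul hF2 hF2) (show n ≤ b by omega)).trans_eq (by ring)
  have hD : n * (F * F * n + 1) ≤ b ^ 7 :=
    (Nat.mul_le_mul (show n ≤ b by omega) (show F * F * n + 1 ≤ b ^ 6 by
      have := hpos 5
      omega)).trans_eq (by ring)
  have := hpos 7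
  have := hpos 5
  refine ⟨?_, ?_, ?_, ?_⟩ <;> omega

/-- The condition `k ≤ m + 1` covers both applications: `m = 0`, `k = 1` for exact minimization and
`m = ⌊k⌋₊` for approximation. -/
theorem minimizeProg_returns {n : ℕ} (hn : 1 ≤ n) {f : Finset (Fin n) → ℤ} (hf : IsSubmodular f)
    {T : ℕ} (hT : 1 ≤ T) {m : ℕ} {k : ℝ} (hk : 0 < k) (hkn : k ≤ n) (hkm : k ≤ m + 1)
    (hmn : m ≤ n) :
    ∃ (S : Finset (Fin n)) (t : ℕ),
      minimizeProg.Returns f T ((n + maxAbs f + 2) ^ 8) m S t ∧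
      (∀ A : Finset (Fin n), f S ≤ f A + m) ∧
      (t : ℝ) ≤ 390 * ((n : ℝ) ^ 6 * ((max 1 (maxMarginal f) : ℕ) : ℝ) ^ 2 / k ^ 4 * T) := by
  have hM : max 1 (maxMarginal f) ≤ max 1 (2 * maxAbs f) := max_le_max_left 1 (maxMarginal_le f)
  obtain ⟨hW₁, hW₂, -⟩ := wordSize_bounds (n := n) (a := maxAbs f) (Nat.zero_le _)
  have hval : ∀ S, |f S| ≤ (((n + maxAbs f + 2) ^ 8 : ℕ) : ℤ) := fun S =>
    (abs_le_maxAbs f S).trans (by omega)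
  have hdiff : ∀ S U, |f S - f U| ≤ (((n + maxAbs f + 2) ^ 8 : ℕ) : ℤ) := fun S U => by
    have h1 := abs_le_maxAbs f S
    have h2 := abs_le_maxAbs f U
    rw [abs_le] at h1 h2 ⊢
    omega
  obtain ⟨F, hF, s, t, hex, ht, hS⟩ := minimizeProg_spec (T := T) hf hn
    (show n ≤ (n + maxAbs f + 2) ^ 8 by omega) hval hdiff (show m + 1 ≤ _ by omega)
    fun F hF => (wordSize_bounds (hF.trans hM)).2.2
  refine ⟨s.readSet n 0, t, ⟨s, hex, rfl⟩, hS, ?_⟩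
  set M := max 1 (maxMarginal f)
  have ht' : (t : ℝ) ≤ 130 * (stepCount n m F * ((n : ℝ) ^ 2 * T)) := by
    have := ht.trans (runTime_le hn hT)
    rw [zero_add] at this
    exact_mod_cast this
  have hsc := stepCount_le (le_max_left _ _) hF hk hkm hkn
  -- The analysis gives order `n⁴M²T/k²`; this factor of at least `1` weakens it to the stated form.
  have hnk : 1 ≤ (n : ℝ) ^ 2 / k ^ 2 := by
    rw [← div_pow]
    exact one_le_pow₀ ((one_le_div hk).mpr hkn)
  calc (t : ℝ) ≤ 130 * (3 * ((n : ℝ) ^ 2 * (M : ℝ) ^ 2 / k ^ 2) * ((n : ℝ) ^ 2 * T)) := by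
        refine ht'.trans ?_
        gcongr
    _ = 390 * (n ^ 4 * (M : ℝ) ^ 2 / k ^ 2 * T) := by ring
    _ ≤ 390 * (n ^ 4 * (M : ℝ) ^ 2 / k ^ 2 * T) * ((n : ℝ) ^ 2 / k ^ 2) :=
        le_mul_of_one_le_right (by positivity) hnk
    _ = _ := by
      field_simp

end RAM

theorem mainTheorem7 :
    (∃ (P : RAM.Prog) (C : ℝ) (c d : ℕ),
      ∀ (n : ℕ), 1 ≤ n → ∀ f : Finset (Fin n) → ℤ, IsSubmodular f →
      ∀ T : ℕ, 1 ≤ T →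
      ∃ (S : Finset (Fin n)) (t : ℕ),
        P.Returns f T ((n + maxAbs f + 2) ^ d) 0 S t ∧
        (∀ A : Finset (Fin n), f S ≤ f A) ∧
        (t : ℝ) ≤ C * ((n : ℝ) ^ 6 * ((max 1 (maxMarginal f) : ℕ) : ℝ) ^ 2 * T) *
          Real.log (n * (max 1 (maxMarginal f) : ℕ) + 2) ^ c) ∧
    (∃ (P : RAM.Prog) (C : ℝ) (c d : ℕ),
      ∀ (n : ℕ), 1 ≤ n → ∀ f : Finset (Fin n) → ℤ, IsSubmodular f →
      ∀ T : ℕ, 1 ≤ T → ∀ k : ℝ, 0 < k → k ≤ n →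
      ∃ (S : Finset (Fin n)) (t : ℕ),
        P.Returns f T ((n + maxAbs f + 2) ^ d) ⌊k⌋₊ S t ∧
        (∀ A : Finset (Fin n), (f S : ℝ) ≤ f A + k) ∧
        (t : ℝ) ≤ C * ((n : ℝ) ^ 6 * ((max 1 (maxMarginal f) : ℕ) : ℝ) ^ 2 / k ^ 4 * T) *
          Real.log (n * (max 1 (maxMarginal f) : ℕ) + 2) ^ c) := by
  -- The same program serves both claims, with logarithmic exponent `0`; the constant is `390 = 130
  -- · 3`.
  refine ⟨⟨RAM.minimizeProg, 390, 0, 8, fun n hn f hf T hT => ?_⟩,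
    RAM.minimizeProg, 390, 0, 8, fun n hn f hf T hT k hk hkn => ?_⟩
  · obtain ⟨S, t, hr, hS, ht⟩ := RAM.minimizeProg_returns hn hf hT (m := 0) one_pos
      (by exact_mod_cast hn) (by simp) (Nat.zero_le n)
    refine ⟨S, t, hr, by simpa using hS, ?_⟩
    simpa using ht
  · obtain ⟨S, t, hr, hS, ht⟩ := RAM.minimizeProg_returns hn hf hT (m := ⌊k⌋₊) hk hkn
      (Nat.lt_floor_add_one k).le (Nat.floor_le_of_le hkn)
    refine ⟨S, t, hr, fun A => ?_, by simpa using ht⟩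
    have h : (f S : ℝ) ≤ f A + (⌊k⌋₊ : ℝ) := by exact_mod_cast hS A
    linarith [Nat.floor_le hk.le]
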